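/- For $p\ge 0$ put $$\mathcal F(p)=\begin{cases}\dfrac{2p+1}{p+1}, & 0\le p<1,\\[2mm] \dfrac{7p-1}{4p}, & p\ge 1.\end{cases}$$ Let $n\in\mathbb N$, $p\ge 0$, $0\le\mu\le h$, and let $\eta:[0,\infty)\to\mathbb R$ satisfy $|\eta(t)|\le\mu$ for all $t\ge 0$. Suppose that the delay $\tau(t)=h+\eta(t)$ is differentiable almost everywhere on $[0,\infty)$ with $\dot\tau(t)\le 1+p$ for almost all $t\ge 0$, this bound being understood also in integrated form, i.e. $\tau(t)-\tau(s)\le(1+p)(t-s)$ for all $0\le s\le t$ (which is automatic if $\tau$ is locally absolutely continuous). Let $\|v\|^2=\int_0^\infty\|v(t)\|^2\,dt$ denote the squared norm in $L_2([0,\infty);\mathbb C^n)$. Then for every $y\in L_2([0,\infty);\mathbb C^n)$, extended so that $y(t)=0$ for all $t\le 0$, the function (oriented integral) $$z(t)=\int_{-h-\eta(t)}^{-h}y(t+s)\,ds,\qquad t\ge 0,$$ belongs to $L_2([0,\infty);\mathbb C^n)$ and $$\|z\|^2\le\mu^2\,\mathcal F(p)\,\|y\|^2 .$$ Equivalently,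 if $\mu>0$, the function $u=-\frac{1}{\mu\sqrt{\mathcal F(p)}}\,z$ belongs to $L_2([0,\infty);\mathbb C^n)$ and satisfies $\|u\|^2\le\|y\|^2$. Moreover, $\mathcal F$ is continuous and strictly increasing on $[0,\infty)$, $\mathcal F(0)=1$, $1<\mathcal F(p)<\frac74$ for all $p>0$, and $\lim_{p\to\infty}\mathcal F(p)=\frac74$. -/

import Mathlib

open MeasureTheory Set Filter Topology

noncomputable section

/-- The bound `𝓕(p)`, meaningful for `p ≥ 0`. -/
def calF (p : ℝ) : ℝ :=
  if p < 1 then (2 * p + 1) / (p + 1) else (7 * p - 1) / (4 * p)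

/-- Moderately varying delay: `τ(t) = h + η(t)` for `t ≥ 0`, with `|η| ≤ μ ≤ h`, differentiable
almost everywhere, with `τ̇ ≤ 1 + p` and `p ≥ 0`.

The inequality `τ̇ ≤ 1 + p` is required both pointwise almost everywhere and in integrated form.
For locally absolutely continuous `τ` the integrated form follows from the pointwise one. Without
it a step function jumping upwards would count as a delay with `τ̇ = 0`. Downward jumps, as in
sawtooth delays coming from sampling, are allowed. -/
structure IsModeratelyVarying (h μ p : ℝ) (η : ℝ → ℝ) : Prop where
  p_nonneg : 0 ≤ p
  mu_le : μ ≤ h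
  abs_le : ∀ t, 0 ≤ t → |η t| ≤ μ
  ae_differentiable : ∀ᵐ t ∂(volume.restrict (Ici (0 : ℝ))),
    DifferentiableAt ℝ (fun r => h + η r) t
  ae_deriv_le : ∀ᵐ t ∂(volume.restrict (Ici (0 : ℝ))), deriv (fun r => h + η r) t ≤ 1 + p
  increment_le : ∀ s t, 0 ≤ s → s ≤ t → (h + η t) - (h + η s) ≤ (1 + p) * (t - s)

/-- Membership in `L₂[0, ∞)` for `ℂⁿ`-valued functions. -/
def InL2 {n : ℕ} (v : ℝ → EuclideanSpace ℂ (Fin n)) : Prop :=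
  MemLp v 2 (volume.restrict (Ici (0 : ℝ)))

/-- The squared `L₂[0, ∞)`-norm of a function in `L₂[0, ∞)`. -/
def normSqL2 {n : ℕ} (v : ℝ → EuclideanSpace ℂ (Fin n)) : ℝ :=
  ∫ t in Ici (0 : ℝ), ‖v t‖ ^ 2

/-- The integral operator `(Δ y)(t) = ∫_{-h-η(t)}^{-h} y(t+s) ds` (an oriented integral). -/
def delayOp {n : ℕ} (h : ℝ) (η : ℝ → ℝ) (y : ℝ → EuclideanSpace ℂ (Fin n)) (t : ℝ) :
    EuclideanSpace ℂ (Fin n) :=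
  ∫ s in (-h - η t)..(-h), y (t + s)

/-- The feedback `u(t) = -(1 / (μ √𝓕(p))) ∫_{-h-η(t)}^{-h} y(t+s) ds`, for `μ > 0`. -/
def feedback {n : ℕ} (h μ p : ℝ) (η : ℝ → ℝ) (y : ℝ → EuclideanSpace ℂ (Fin n)) (t : ℝ) :
    EuclideanSpace ℂ (Fin n) :=
  -((1 / (μ * √(calF p))) • delayOp h η y t)

end

noncomputable section

open scoped ENNReal

/-! The operator `T : y ↦ z` is dominated by the 0-1 kernel of the intervals `I_t` between `t - h -
η t` and `t - h`, so `T T*` has kernel `|I_t ∩ I_s|`. Schur's test with constant weight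
(`lintegral_sq_kernel_le`) reduces the bound to `∫ |I_t ∩ I_s| ds ≤ μ² 𝓕(p)` for every `t`. As `I_t`
lies in an interval `J` of length `μ`, it suffices to bound `∫ |J ∩ I_s| ds`; rescaling gives `μ =
1` and `J = [0, 1]`, with integrand `overlap x (η x)`.

Pointwise this is at most `envelope x`, of total mass `7/4`. To attain the envelope, `η` would have
to be `-1` left of `1/2` and jump to `1` there, which the one-sided slope bound `1 + p` forbids.
`exists_switching` locates the sign change in an interval `[b, d]`; the slope bound forces a loss
`lossBound p b w` at `b - w`, and by reflection `lossBound p (1 - d) w` at `d + w`. Since `b + (1 -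
d) ≤ 1`, the integrated loss is at least its value for `b = d = 1/2`, which is `7/4 - 𝓕(p)`
(`le_integral_lossBound_pair`, `integral_overlap_le`). -/

theorem integral_of_affine {f : ℝ → ℝ} {a b α β : ℝ} (hab : a ≤ b)
    (hf : ∀ x ∈ Ioo a b, f x = α + β * x) :
    IntervalIntegrable f volume a b ∧
      ∫ x in a..b, f x = α * (b - a) + β * (b ^ 2 - a ^ 2) / 2 := by
  have hg : IntervalIntegrable (fun x => α + β * x) volume a b :=
    (by fun_prop : Continuous fun x : ℝ => α + β * x).intervalIntegrable _ _
  constructor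
  · refine hg.congr_uIoo fun x hx => ?_
    rw [uIoo_of_le hab] at hx
    exact (hf x hx).symm
  · rw [intervalIntegral.integral_congr_uIoo (g := fun x => α + β * x)]
    · rw [intervalIntegral.integral_add (by simp) (by
        exact (by fun_prop : Continuous fun x : ℝ => β * x).intervalIntegrable _ _)]
      rw [intervalIntegral.integral_const_mul, integral_id, intervalIntegral.integral_const,
        smul_eq_mul]
      ring
    · intro x hx
      rw [uIoo_of_le hab] at hx
      exact hf x hx

/-! ### Overlap, envelope and the pointwise loss. -/

/-- The length of the part of `[0, 1]` lying between `x - e` and `x`. -/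
def overlap (x e : ℝ) : ℝ := |max 0 (min 1 x) - max 0 (min 1 (x - e))|

/-- The maximum of `overlap x e` over `|e| ≤ 1`. -/
def envelope (x : ℝ) : ℝ :=
  if x ≤ 0 then max 0 (1 + x) else if x ≤ 1 then max x (1 - x) else max 0 (2 - x)

/-- A lower bound for `envelope - overlap` at distance `w` to the left of the point `b` where `e`
starts being positive. -/
def lossBound (p b w : ℝ) : ℝ :=
  if w ≤ b then max 0 (2 * (b - w) - 1) + max 0 (1 - b - p * w) else max 0 (1 - (1 + p) * w)

theorem overlap_le_envelope {x e : ℝ} (he : |e| ≤ 1) : overlap x e ≤ envelope x := by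
  obtain ⟨h1, h2⟩ := abs_le.1 he
  unfold overlap envelope
  rw [abs_le]
  constructor <;> simp only [max_def, min_def] <;> split_ifs <;> linarith

/-- Reflecting the line about `1/2` preserves `[0, 1]`; this symmetry transfers the estimate left of
`b` to the right of `d`. -/
theorem overlap_one_sub (x e : ℝ) : overlap (1 - x) (-e) = overlap x e := by
  have key : ∀ y : ℝ, max 0 (min 1 (1 - y)) = 1 - max 0 (min 1 y) := by
    intro y
    simp only [max_def, min_def]
    split_ifs <;> linarith
  unfold overlap
  rw [show 1 - x - -e = 1 - (x - e) by ring, key, key, abs_sub_comm]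
  congr 1
  ring

theorem envelope_one_sub (x : ℝ) : envelope (1 - x) = envelope x := by
  unfold envelope
  simp only [max_def]
  split_ifs <;> linarith

/-- On `[0, b)` two losses add up: `e ≤ 0` has the wrong sign beyond `1/2`, costing `2x - 1`, and
`-e ≤ (1 + p) w` may fall short of the available length `1 - x`. For `x < 0` only the second
mechanism remains. At `b = 1` the slope condition may be absent, but the terms it would justify
vanish. -/
theorem lossBound_le_left {p b w e : ℝ} (hp : 0 ≤ p) (hb0 : 0 ≤ b) (hb1 : b ≤ 1) (hw : 0 < w)
    (he : |e| ≤ 1) (hneg : 0 ≤ b - w → e ≤ 0) (hlow : b < 1 → -((1 + p) * w) ≤ e) :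
    lossBound p b w ≤ envelope (b - w) - overlap (b - w) e := by
  obtain ⟨h1, h2⟩ := abs_le.1 he
  have hq : 0 ≤ p * w := by positivity
  rw [add_mul, one_mul] at hlow
  unfold lossBound
  rw [add_mul, one_mul]
  generalize p * w = q at *
  rcases le_or_gt w b with hwb | hwb
  · have he0 := hneg (by linarith)
    have hov : overlap (b - w) e ≤ min (1 - (b - w)) (-e) := by
      unfold overlap
      rw [min_eq_right (by linarith : b - w ≤ 1), max_eq_right (by linarith : 0 ≤ b - w),
        le_min_iff, abs_le, abs_le]
      refine ⟨⟨?_, ?_⟩, ?_, ?_⟩ <;> simp only [max_def, min_def] <;> split_ifs <;> linarith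
    have hen : envelope (b - w) = max 0 (2 * (b - w) - 1) + (1 - (b - w)) := by
      unfold envelope
      simp only [max_def]
      split_ifs <;> linarith
    have h3 := hov.trans (min_le_left _ _)
    have h4 := hov.trans (min_le_right _ _)
    rw [if_pos hwb, hen]
    have : max 0 (1 - b - q) ≤ 1 - (b - w) - overlap (b - w) e := by
      refine max_le (by linarith) ?_
      rcases hb1.lt_or_eq with hb | rfl
      · linarith [hlow hb]
      · linarith
    linarith
  · have hov : overlap (b - w) e ≤ max 0 (b - w - e) := by
      unfold overlap
      rw [min_eq_right (by linarith : b - w ≤ 1), max_eq_left (by linarith : b - w ≤ 0), zero_sub,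
        abs_neg, abs_of_nonneg (le_max_left _ _)]
      exact max_le_max_left _ (min_le_right _ _)
    have hen : envelope (b - w) = max 0 (1 + (b - w)) := by
      unfold envelope
      rw [if_pos (by linarith)]
    have h3 := overlap_le_envelope (x := b - w) he
    rw [if_neg hwb.not_ge]
    refine max_le (by linarith) ?_
    rcases hb1.lt_or_eq with hb | rfl
    · have := hlow hb
      have := le_max_right 0 (1 + (b - w))
      rcases max_cases 0 (b - w - e) with h | h <;> linarith
    · linarith

theorem lossBound_le_right {p d w e : ℝ} (hp : 0 ≤ p) (hd0 : 0 ≤ d) (hd1 : d ≤ 1) (hw : 0 < w)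
    (he : |e| ≤ 1) (hpos : d + w ≤ 1 → 0 ≤ e) (hup : 0 < d → e ≤ (1 + p) * w) :
    lossBound p (1 - d) w ≤ envelope (d + w) - overlap (d + w) e := by
  have := lossBound_le_left (e := -e) hp (sub_nonneg.2 hd1) (by linarith : 1 - d ≤ 1) hw
    (by rwa [abs_neg]) (fun h => by linarith [hpos (by linarith)])
    (fun h => by linarith [hup (by linarith)])
  rwa [show 1 - d - w = 1 - (d + w) by ring, overlap_one_sub, envelope_one_sub] at this

/-- Switching before `1/2` only increases the shortfall `1 - b - p w`, and the wrong-sign term is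
already zero at `b = 1/2`. -/
theorem lossBound_half_le {p b w : ℝ} (hp : 0 ≤ p) (hw : 0 ≤ w) (hb : b ≤ 1 / 2) :
    lossBound p (1 / 2) w ≤ lossBound p b w := by
  have hq : 0 ≤ p * w := by positivity
  unfold lossBound
  rw [add_mul, one_mul]
  generalize p * w = q at *
  simp only [max_def]
  split_ifs <;> linarith

/-- The pointwise comparison with the symmetric case can fail when `b > 1/2`. The ramp is the
wrong-sign gain of `b`; the hat absorbs the deficit for `w` near `1/2`, where `lossBound` at `b` or
`c` is on a different branch than at `1/2`. Both corrections have integral `(b - 1/2)²`, so they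
cancel. -/
theorem lossBound_half_pair_le {p b c w : ℝ} (hp : 0 ≤ p) (hw : 0 ≤ w) (hb : 1 / 2 ≤ b)
    (hb1 : b ≤ 1) (hbc : b + c ≤ 1) :
    2 * lossBound p (1 / 2) w + 2 * max 0 (b - 1 / 2 - w) - max 0 (b - 1 / 2 - |w - 1 / 2|) ≤
      lossBound p b w + lossBound p c w := by
  have hq : 0 ≤ p * w := by positivity
  unfold lossBound
  rw [add_mul, one_mul]
  generalize p * w = q at *
  have : max 0 (b - 1 / 2 - |w - 1 / 2|) = max 0 (min (b - w) (b - 1 + w)) := by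
    congr 1
    rcases le_total w (1 / 2) with h | h
    · rw [abs_of_nonpos (by linarith), min_eq_right (by linarith)]; ring
    · rw [abs_of_nonneg (by linarith), min_eq_left (by linarith)]; ring
  rw [this]
  have h1 := le_max_left 0 (min (b - w) (b - 1 + w))
  have h2 := le_max_right 0 (min (b - w) (b - 1 + w))
  generalize max 0 (min (b - w) (b - 1 + w)) = m at *
  have h3 : 2 * (1 / 2 - w) - 1 ≤ 0 := by linarith
  rw [max_eq_left h3]
  have r1 := le_max_left 0 (2 * (b - w) - 1)
  have r2 := le_max_right 0 (2 * (b - w) - 1)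
  have r3 := le_max_left 0 (1 - b - q)
  have r4 := le_max_right 0 (1 - b - q)
  have r5 := le_max_left 0 (1 - c - q)
  have r6 := le_max_right 0 (1 - c - q)
  have r7 := le_max_left 0 (2 * (c - w) - 1)
  generalize max 0 (2 * (b - w) - 1) = m1 at *
  generalize max 0 (1 - b - q) = m2 at *
  generalize max 0 (1 - c - q) = m3 at *
  generalize max 0 (2 * (c - w) - 1) = m4 at *
  rcases le_total w (1 / 2) with hw2 | hw2
  · rw [min_eq_right (by linarith)] at h2
    rw [if_pos hw2, if_pos (hw2.trans hb)]
    rcases max_cases 0 (1 - 1 / 2 - q) with ⟨e1, g1⟩ | ⟨e1, g1⟩ <;>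
      rcases max_cases 0 (b - 1 / 2 - w) with ⟨e2, g2⟩ | ⟨e2, g2⟩ <;> rw [e1, e2] <;>
      split_ifs <;>
      linarith [le_max_left 0 (1 - (w + q)), le_max_right 0 (1 - (w + q))]
  · rw [min_eq_left (by linarith)] at h2
    rw [max_eq_left (by linarith : b - 1 / 2 - w ≤ 0)]
    rcases max_cases 0 (1 - (w + q)) with ⟨e1, g1⟩ | ⟨e1, g1⟩ <;>
      rcases max_cases 0 (1 - 1 / 2 - q) with ⟨e2, g2⟩ | ⟨e2, g2⟩ <;> rw [e1, e2] <;>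
      split_ifs <;> linarith

/-! ### Integrals of the loss bound and of the envelope. -/

theorem continuous_lossBound (p b : ℝ) : Continuous (lossBound p b) := by
  unfold lossBound
  refine Continuous.if_le (by fun_prop) (by fun_prop) (by fun_prop) (by fun_prop) ?_
  rintro w rfl
  rw [show 2 * (w - w) - 1 = -1 by ring]
  rw [max_eq_left (by norm_num : (-1 : ℝ) ≤ 0), zero_add]
  congr 1
  ring

theorem integral_lossBound_half {p : ℝ} (hp : 0 ≤ p) :
    ∫ w in (0 : ℝ)..2, lossBound p (1 / 2) w = (7 / 4 - calF p) / 2 := by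
  unfold calF
  split_ifs with h
  -- For `p < 1` the loss is still positive at the branch point `1/2` and dies out at `1 / (1 + p)`.
  · have hp1 : (0 : ℝ) < 1 + p := by linarith
    have e1 : 1 / 2 ≤ 1 / (1 + p) := by gcongr; linarith
    have e2 : 1 / (1 + p) ≤ 1 := by rw [div_le_one hp1]; linarith
    have e3 : (1 + p) * (1 / (1 + p)) = 1 := by field_simp
    obtain ⟨i1, v1⟩ := integral_of_affine (f := lossBound p (1 / 2)) (a := 0) (b := 1 / 2)
      (α := 1 / 2) (β := -p) (by norm_num) (fun w hw => by
        have := mul_le_mul h.le hw.2.le hw.1.le zero_le_one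
        unfold lossBound
        rw [if_pos hw.2.le, max_eq_left (by linarith [hw.1]), max_eq_right (by linarith)]
        ring)
    obtain ⟨i2, v2⟩ := integral_of_affine (f := lossBound p (1 / 2)) (a := 1 / 2)
      (b := 1 / (1 + p)) (α := 1) (β := -(1 + p)) e1 (fun w hw => by
        have := mul_le_mul_of_nonneg_left hw.2.le hp1.le
        unfold lossBound
        rw [if_neg hw.1.not_ge, max_eq_right (by linarith)]
        ring)
    obtain ⟨i3, v3⟩ := integral_of_affine (f := lossBound p (1 / 2)) (a := 1 / (1 + p))
      (b := 2) (α := 0) (β := 0) (by linarith) (fun w hw => by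
        have := mul_le_mul_of_nonneg_left hw.1.le hp1.le
        unfold lossBound
        rw [if_neg (by linarith [hw.1]), max_eq_left (by linarith)]
        ring)
    rw [← intervalIntegral.integral_add_adjacent_intervals (i1.trans i2) i3,
      ← intervalIntegral.integral_add_adjacent_intervals i1 i2, v1, v2, v3]
    field_simp
    ring
  -- For `p ≥ 1` the loss is exhausted at `1 / (2 * p)`, on the first branch; hence the two formulas
  -- for `calF`.
  · have hp1 : 1 ≤ p := not_lt.1 h
    have hp0 : 0 < p := by linarith
    have e1 : 1 / (2 * p) ≤ 1 / 2 := by gcongr; linarith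
    have e2 : p * (1 / (2 * p)) = 1 / 2 := by field_simp
    obtain ⟨i1, v1⟩ := integral_of_affine (f := lossBound p (1 / 2)) (a := 0) (b := 1 / (2 * p))
      (α := 1 / 2) (β := -p) (by positivity) (fun w hw => by
        have := mul_le_mul_of_nonneg_left hw.2.le hp
        unfold lossBound
        rw [if_pos (by linarith [hw.2]), max_eq_left (by linarith [hw.1]),
          max_eq_right (by linarith)]
        ring)
    obtain ⟨i2, v2⟩ := integral_of_affine (f := lossBound p (1 / 2)) (a := 1 / (2 * p))
      (b := 2) (α := 0) (β := 0) (by linarith) (fun w hw => by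
        have := mul_le_mul_of_nonneg_left hw.1.le hp
        have : 0 < 1 / (2 * p) := by positivity
        have := hw.1
        unfold lossBound
        split_ifs
        · rw [max_eq_left (by linarith), max_eq_left (by linarith)]
          ring
        · rw [max_eq_left (by linarith)]
          ring)
    rw [← intervalIntegral.integral_add_adjacent_intervals i1 i2, v1, v2]
    field_simp
    ring

theorem integral_ramp {δ : ℝ} (h0 : 0 ≤ δ) (h1 : δ ≤ 1 / 2) :
    ∫ w in (0 : ℝ)..2, max 0 (δ - w) = δ ^ 2 / 2 := by
  obtain ⟨i1, v1⟩ := integral_of_affine (f := fun w => max 0 (δ - w)) (a := 0) (b := δ)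
    (α := δ) (β := -1) h0 (fun w hw => by rw [max_eq_right (by linarith [hw.2])]; ring)
  obtain ⟨i2, v2⟩ := integral_of_affine (f := fun w => max 0 (δ - w)) (a := δ) (b := 2)
    (α := 0) (β := 0) (by linarith) (fun w hw => by rw [max_eq_left (by linarith [hw.1])]; ring)
  rw [← intervalIntegral.integral_add_adjacent_intervals i1 i2, v1, v2]
  ring

theorem integral_hat {δ : ℝ} (h0 : 0 ≤ δ) (h1 : δ ≤ 1 / 2) :
    ∫ w in (0 : ℝ)..2, max 0 (δ - |w - 1 / 2|) = δ ^ 2 := by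
  obtain ⟨i1, v1⟩ := integral_of_affine (f := fun w => max 0 (δ - |w - 1 / 2|)) (a := 0)
    (b := 1 / 2 - δ) (α := 0) (β := 0) (by linarith) (fun w hw => by
      have := hw.2
      rw [abs_of_nonpos (by linarith), max_eq_left (by linarith)]; ring)
  obtain ⟨i2, v2⟩ := integral_of_affine (f := fun w => max 0 (δ - |w - 1 / 2|)) (a := 1 / 2 - δ)
    (b := 1 / 2) (α := δ - 1 / 2) (β := 1) (by linarith) (fun w hw => by
      have := hw.1; have := hw.2
      rw [abs_of_nonpos (by linarith), max_eq_right (by linarith)]; ring)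
  obtain ⟨i3, v3⟩ := integral_of_affine (f := fun w => max 0 (δ - |w - 1 / 2|)) (a := 1 / 2)
    (b := 1 / 2 + δ) (α := δ + 1 / 2) (β := -1) (by linarith) (fun w hw => by
      have := hw.1; have := hw.2
      rw [abs_of_nonneg (by linarith), max_eq_right (by linarith)]; ring)
  obtain ⟨i4, v4⟩ := integral_of_affine (f := fun w => max 0 (δ - |w - 1 / 2|))
    (a := 1 / 2 + δ) (b := 2) (α := 0) (β := 0) (by linarith) (fun w hw => by
      have := hw.1
      rw [abs_of_nonneg (by linarith), max_eq_left (by linarith)]; ring)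
  rw [← intervalIntegral.integral_add_adjacent_intervals ((i1.trans i2).trans i3) i4,
    ← intervalIntegral.integral_add_adjacent_intervals (i1.trans i2) i3,
    ← intervalIntegral.integral_add_adjacent_intervals i1 i2, v1, v2, v3, v4]
  ring

theorem le_integral_lossBound_pair_of_half_le {p b c : ℝ} (hp : 0 ≤ p) (hb : 1 / 2 ≤ b)
    (hb1 : b ≤ 1) (hbc : b + c ≤ 1) :
    7 / 4 - calF p ≤ ∫ w in (0 : ℝ)..2, (lossBound p b w + lossBound p c w) := by
  have hL := continuous_lossBound p (1 / 2)
  have hLb := continuous_lossBound p b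
  have hLc := continuous_lossBound p c
  have i1 : IntervalIntegrable (fun w => 2 * lossBound p (1 / 2) w) volume 0 2 :=
    (hL.const_mul 2).intervalIntegrable _ _
  have i2 : IntervalIntegrable (fun w => 2 * max 0 (b - 1 / 2 - w)) volume 0 2 :=
    (by fun_prop : Continuous fun w : ℝ => 2 * max 0 (b - 1 / 2 - w)).intervalIntegrable _ _
  have i3 : IntervalIntegrable (fun w => max 0 (b - 1 / 2 - |w - 1 / 2|)) volume 0 2 :=
    (by fun_prop : Continuous fun w : ℝ =>
      max 0 (b - 1 / 2 - |w - 1 / 2|)).intervalIntegrable _ _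
  calc 7 / 4 - calF p
      = ∫ w in (0 : ℝ)..2, (2 * lossBound p (1 / 2) w + 2 * max 0 (b - 1 / 2 - w)
          - max 0 (b - 1 / 2 - |w - 1 / 2|)) := by
        rw [intervalIntegral.integral_sub (i1.add i2) i3, intervalIntegral.integral_add i1 i2,
          intervalIntegral.integral_const_mul, intervalIntegral.integral_const_mul,
          integral_lossBound_half hp, integral_ramp (by linarith) (by linarith),
          integral_hat (by linarith) (by linarith)]
        ring
    _ ≤ _ := intervalIntegral.integral_mono_on (by norm_num) ((i1.add i2).sub i3)
        ((hLb.add hLc).intervalIntegrable _ _)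
        (fun w hw => lossBound_half_pair_le hp hw.1 hb hb1 hbc)

theorem le_integral_lossBound_pair {p b c : ℝ} (hp : 0 ≤ p) (hb1 : b ≤ 1) (hc1 : c ≤ 1)
    (hbc : b + c ≤ 1) :
    7 / 4 - calF p ≤ ∫ w in (0 : ℝ)..2, (lossBound p b w + lossBound p c w) := by
  rcases le_total (1 / 2) b with hb | hb
  · exact le_integral_lossBound_pair_of_half_le hp hb hb1 hbc
  rcases le_total (1 / 2) c with hc | hc
  · simp_rw [add_comm (lossBound p b _)]
    exact le_integral_lossBound_pair_of_half_le hp hc hc1 (by linarith)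
  have hL := continuous_lossBound p (1 / 2)
  calc 7 / 4 - calF p = ∫ w in (0 : ℝ)..2, 2 * lossBound p (1 / 2) w := by
        rw [intervalIntegral.integral_const_mul, integral_lossBound_half hp]
        ring
    _ ≤ _ := intervalIntegral.integral_mono_on (by norm_num)
        ((hL.const_mul 2).intervalIntegrable _ _)
        (((continuous_lossBound p b).add (continuous_lossBound p c)).intervalIntegrable
          _ _)
        (fun w hw => by
          have h1 := lossBound_half_le hp hw.1 hb
          have h2 := lossBound_half_le hp hw.1 hc
          simp only [Pi.add_apply]
          linarith)

theorem integral_envelope {a c : ℝ} (ha : a ≤ -1) (hc : 2 ≤ c) :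
    IntervalIntegrable envelope volume a c ∧ ∫ x in a..c, envelope x = 7 / 4 := by
  obtain ⟨i1, v1⟩ := integral_of_affine (f := envelope) (a := a) (b := -1) (α := 0) (β := 0) ha
    (fun x hx => by
      have := hx.2
      unfold envelope
      rw [if_pos (by linarith), max_eq_left (by linarith)]; ring)
  obtain ⟨i2, v2⟩ := integral_of_affine (f := envelope) (a := -1) (b := 0) (α := 1) (β := 1)
    (by norm_num) (fun x hx => by
      have := hx.1; have := hx.2
      unfold envelope
      rw [if_pos (by linarith), max_eq_right (by linarith)]; ring)
  obtain ⟨i3, v3⟩ := integral_of_affine (f := envelope) (a := 0) (b := 1 / 2) (α := 1) (β := -1)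
    (by norm_num) (fun x hx => by
      have := hx.1; have := hx.2
      unfold envelope
      rw [if_neg (by linarith), if_pos (by linarith), max_eq_right (by linarith)]; ring)
  obtain ⟨i4, v4⟩ := integral_of_affine (f := envelope) (a := 1 / 2) (b := 1) (α := 0) (β := 1)
    (by norm_num) (fun x hx => by
      have := hx.1; have := hx.2
      unfold envelope
      rw [if_neg (by linarith), if_pos (by linarith), max_eq_left (by linarith)]; ring)
  obtain ⟨i5, v5⟩ := integral_of_affine (f := envelope) (a := 1) (b := 2) (α := 2) (β := -1)
    (by norm_num) (fun x hx => by
      have := hx.1; have := hx.2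
      unfold envelope
      rw [if_neg (by linarith), if_neg (by linarith), max_eq_right (by linarith)]; ring)
  obtain ⟨i6, v6⟩ := integral_of_affine (f := envelope) (a := 2) (b := c) (α := 0) (β := 0) hc
    (fun x hx => by
      have := hx.1
      unfold envelope
      rw [if_neg (by linarith), if_neg (by linarith), max_eq_left (by linarith)]; ring)
  have j2 := i1.trans i2
  have j3 := j2.trans i3
  have j4 := j3.trans i4
  have j5 := j4.trans i5
  refine ⟨j5.trans i6, ?_⟩
  rw [← intervalIntegral.integral_add_adjacent_intervals j5 i6,
    ← intervalIntegral.integral_add_adjacent_intervals j4 i5,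
    ← intervalIntegral.integral_add_adjacent_intervals j3 i4,
    ← intervalIntegral.integral_add_adjacent_intervals j2 i3,
    ← intervalIntegral.integral_add_adjacent_intervals i1 i2, v1, v2, v3, v4, v5, v6]
  norm_num

/-! ### The integrated overlap is at most `𝓕(p)`. -/

theorem measurable_overlap {η : ℝ → ℝ} (hη : Measurable η) :
    Measurable fun x => overlap x (η x) := by
  unfold overlap
  fun_prop

theorem overlap_nonneg (x e : ℝ) : 0 ≤ overlap x e := abs_nonneg _

theorem overlap_eq_zero {x e : ℝ} (he : |e| ≤ 1) (hx : x ∉ Ioo (-1) 2) : overlap x e = 0 := by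
  refine le_antisymm ((overlap_le_envelope he).trans ?_) (overlap_nonneg x e)
  unfold envelope
  rw [mem_Ioo, not_and_or, not_lt, not_lt] at hx
  simp only [max_def]
  rcases hx with hx | hx <;> split_ifs <;> linarith

theorem overlap_le_one (x e : ℝ) : overlap x e ≤ 1 := by
  unfold overlap
  have h : ∀ y : ℝ, 0 ≤ max 0 (min 1 y) ∧ max 0 (min 1 y) ≤ 1 := fun y =>
    ⟨le_max_left _ _, max_le zero_le_one (min_le_left _ _)⟩
  rw [abs_le]
  constructor <;> linarith [(h x).1, (h x).2, (h (x - e)).1, (h (x - e)).2]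

/-- A switching interval `[b, d]`: to its left `η ≤ 0` on `[0, 1]`, to its right `0 ≤ η`. -/
theorem exists_switching {p : ℝ} {η : ℝ → ℝ} (hp : 0 ≤ p)
    (hinc : ∀ s x, s ≤ x → η x - η s ≤ (1 + p) * (x - s)) :
    ∃ b d : ℝ, 0 ≤ b ∧ b ≤ d ∧ d ≤ 1 ∧
      (∀ x, 0 ≤ x → x < b → η x ≤ 0) ∧ (∀ x, d < x → x ≤ 1 → 0 ≤ η x) ∧
      (b < 1 → ∀ x, x < b → -((1 + p) * (b - x)) ≤ η x) ∧
      (0 < d → ∀ x, d < x → η x ≤ (1 + p) * (x - d)) := by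
  -- The inserted endpoints keep `P` and `N` nonempty when `η` has constant sign on `[0, 1]`; the
  -- conditions `b < 1` and `0 < d` exclude them as witnesses below.
  set P : Set ℝ := insert 1 {x | x ∈ Icc (0 : ℝ) 1 ∧ 0 < η x} with hP
  set N : Set ℝ := insert 0 {x | x ∈ Icc (0 : ℝ) 1 ∧ η x ≤ 0} with hN
  have hP0 : ∀ x ∈ P, 0 ≤ x := by
    rintro x (rfl | hx)
    exacts [zero_le_one, hx.1.1]
  have hN1 : ∀ x ∈ N, x ≤ 1 := by
    rintro x (rfl | hx)
    exacts [zero_le_one, hx.1.2]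
  have hPb : BddBelow P := ⟨0, hP0⟩
  have hNb : BddAbove N := ⟨1, hN1⟩
  have hPn : P.Nonempty := ⟨1, mem_insert _ _⟩
  have hNn : N.Nonempty := ⟨0, mem_insert _ _⟩
  have hb0 : 0 ≤ sInf P := le_csInf hPn hP0
  have hb1 : sInf P ≤ 1 := csInf_le hPb (mem_insert _ _)
  have hd0 : 0 ≤ sSup N := le_csSup hNb (mem_insert _ _)
  have hd1 : sSup N ≤ 1 := csSup_le hNn hN1
  have hneg : ∀ x, 0 ≤ x → x < sInf P → η x ≤ 0 := by
    intro x hx0 hx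
    by_contra! h
    exact (csInf_le hPb (Or.inr ⟨⟨hx0, hx.le.trans hb1⟩, h⟩)).not_gt hx
  have hpos : ∀ x, sSup N < x → x ≤ 1 → 0 ≤ η x := by
    intro x hx hx1
    by_contra! h
    exact (le_csSup hNb (Or.inr ⟨⟨hd0.trans hx.le, hx1⟩, h.le⟩)).not_gt hx
  refine ⟨sInf P, sSup N, hb0, ?_, hd1, hneg, hpos, ?_, ?_⟩
  · by_contra! h
    obtain ⟨x, hx1, hx2⟩ := exists_between h
    exact (le_csSup hNb (Or.inr ⟨⟨hd0.trans hx1.le, hx2.le.trans hb1⟩,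
      hneg x (hd0.trans hx1.le) hx2⟩)).not_gt hx1
  · intro hb x hx
    by_contra! h
    have hp1 : 0 < 1 + p := by linarith
    -- The line of slope `1 + p` through `(x, η x)` bounds `η` from above and reaches zero only
    -- after `sInf P`, so `η` would still be negative at points of `P` close to the infimum.
    have hc : sInf P < x - η x / (1 + p) := by
      rw [lt_sub_iff_add_lt, ← lt_sub_iff_add_lt', div_lt_iff₀ hp1]
      linarith
    obtain ⟨u, huP, hu⟩ := exists_lt_of_csInf_lt hPn (lt_min hb hc)
    obtain ⟨hu1, hu2⟩ := lt_min_iff.1 hu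
    rcases huP with rfl | hu0
    · exact lt_irrefl _ hu1
    · have h1 := hinc x u (hx.le.trans (csInf_le hPb (Or.inr hu0)))
      rw [lt_sub_iff_add_lt, ← lt_sub_iff_add_lt', div_lt_iff₀ hp1] at hu2
      linarith [hu0.2]
  · intro hd x hx
    by_contra! h
    have hp1 : 0 < 1 + p := by linarith
    have hc : x - η x / (1 + p) < sSup N := by
      rw [sub_lt_comm, lt_div_iff₀ hp1]
      linarith
    obtain ⟨u, huN, hu⟩ := exists_lt_of_lt_csSup hNn (max_lt hd hc)
    obtain ⟨hu1, hu2⟩ := max_lt_iff.1 hu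
    rcases huN with rfl | hu0
    · exact lt_irrefl _ hu1
    · have h1 := hinc u x ((le_csSup hNb (Or.inr hu0)).trans hx.le)
      rw [sub_lt_comm, lt_div_iff₀ hp1] at hu2
      linarith [hu0.2]

theorem integral_overlap_le {p : ℝ} {η : ℝ → ℝ} (hp : 0 ≤ p) (hη : Measurable η)
    (habs : ∀ x, |η x| ≤ 1) (hinc : ∀ s x, s ≤ x → η x - η s ≤ (1 + p) * (x - s)) :
    Integrable (fun x => overlap x (η x)) ∧ ∫ x, overlap x (η x) ≤ calF p := by
  obtain ⟨b, d, hb0, hbd, hd1, hneg, hpos, hlow, hup⟩ := exists_switching hp hinc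
  set f : ℝ → ℝ := fun x => overlap x (η x) with hf
  have hsupp : Function.support f ⊆ Ioo (-1) 2 := by
    intro x hx
    by_contra h
    exact hx (overlap_eq_zero (habs x) h)
  have hint : Integrable f := by
    rw [← integrableOn_iff_integrable_of_support_subset hsupp]
    exact Measure.integrableOn_of_bounded (M := 1) (by simp)
      (measurable_overlap hη).aestronglyMeasurable (ae_of_all _ fun x => by
        rw [Real.norm_of_nonneg (overlap_nonneg _ _)]; exact overlap_le_one _ _)
  refine ⟨hint, ?_⟩
  -- Since `0 ≤ b ≤ d ≤ 1`, the window `[b - 2, d + 2]` contains the support `[-1, 2]`, and its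
  -- outer pieces match `w ∈ [0, 2]`.
  rw [← intervalIntegral.integral_eq_integral_of_support_subset (a := b - 2) (b := d + 2)
    (hsupp.trans fun x hx => ⟨by linarith [hx.1], by linarith [hx.2]⟩)]
  obtain ⟨he, ve⟩ := integral_envelope (a := b - 2) (c := d + 2) (by linarith) (by linarith)
  set g : ℝ → ℝ := fun x => envelope x - f x with hg
  have hg0 : ∀ x, 0 ≤ g x := fun x => sub_nonneg.2 (overlap_le_envelope (habs x))
  have hgi : IntervalIntegrable g volume (b - 2) (d + 2) := he.sub hint.intervalIntegrable
  have hsum : ∫ x in (b - 2)..(d + 2), g x = 7 / 4 - ∫ x in (b - 2)..(d + 2), f x := by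
    rw [hg, intervalIntegral.integral_sub he hint.intervalIntegrable, ve]
  have hsub : ∀ {u v : ℝ}, b - 2 ≤ u → u ≤ v → v ≤ d + 2 → IntervalIntegrable g volume u v := by
    intro u v h1 h2 h3
    refine hgi.mono_set ?_
    rw [uIcc_of_le h2, uIcc_of_le (by linarith)]
    exact Icc_subset_Icc h1 h3
  have g1 := hsub (u := b - 2) (v := b) le_rfl (by linarith) (by linarith)
  have g2 := hsub (u := b) (v := d) (by linarith) hbd (by linarith)
  have g3 := hsub (u := d) (v := d + 2) (by linarith) (by linarith) le_rfl
  have hsplit : ∫ x in (b - 2)..(d + 2), g x =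
      (∫ x in (b - 2)..b, g x) + (∫ x in b..d, g x) + ∫ x in d..(d + 2), g x := by
    rw [← intervalIntegral.integral_add_adjacent_intervals (g1.trans g2) g3,
      ← intervalIntegral.integral_add_adjacent_intervals g1 g2]
  have hmid : 0 ≤ ∫ x in b..d, g x := intervalIntegral.integral_nonneg hbd fun x _ => hg0 x
  have hleft : ∫ w in (0 : ℝ)..2, lossBound p b w ≤ ∫ x in (b - 2)..b, g x := by
    have := intervalIntegral.integral_comp_sub_left g (a := 0) (b := 2) b
    rw [sub_zero] at this
    rw [← this]
    refine intervalIntegral.integral_mono_on_of_le_Ioo (by norm_num)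
      ((continuous_lossBound p b).intervalIntegrable _ _) ?_ fun w hw => ?_
    · simpa using (g1.comp_sub_left b).symm
    · exact lossBound_le_left hp hb0 (hbd.trans hd1) hw.1 (habs _)
        (fun h => hneg _ h (by linarith [hw.1]))
        (fun h => by simpa using hlow h (b - w) (by linarith [hw.1]))
  have hright : ∫ w in (0 : ℝ)..2, lossBound p (1 - d) w ≤ ∫ x in d..(d + 2), g x := by
    have := intervalIntegral.integral_comp_add_left g (a := 0) (b := 2) d
    rw [add_zero] at this
    rw [← this]
    refine intervalIntegral.integral_mono_on_of_le_Ioo (by norm_num)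
      ((continuous_lossBound p (1 - d)).intervalIntegrable _ _) ?_ fun w hw => ?_
    · simpa using g3.comp_add_left d
    · exact lossBound_le_right hp (hb0.trans hbd) hd1 hw.1 (habs _)
        (fun h => hpos _ (by linarith [hw.1]) h)
        (fun h => by simpa using hup h (d + w) (by linarith [hw.1]))
  have hpair := le_integral_lossBound_pair (b := b) (c := 1 - d) hp (hbd.trans hd1)
    (by linarith) (by linarith)
  rw [intervalIntegral.integral_add ((continuous_lossBound p _).intervalIntegrable _ _)
    ((continuous_lossBound p _).intervalIntegrable _ _)] at hpair
  linarith

/-! ### Cauchy–Schwarz and Schur tests for nonnegative kernels. -/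

theorem sq_lintegral_mul_le {α : Type*} [MeasurableSpace α] {μ : Measure α} {f g : α → ℝ≥0∞}
    (hf : AEMeasurable f μ) (hg : AEMeasurable g μ) :
    (∫⁻ x, f x * g x ∂μ) ^ 2 ≤ (∫⁻ x, f x ^ 2 ∂μ) * ∫⁻ x, g x ^ 2 ∂μ := by
  have h := ENNReal.lintegral_mul_le_Lp_mul_Lq μ Real.HolderConjugate.two_two hf hg
  simp only [Pi.mul_apply, ENNReal.rpow_ofNat] at h
  have hs : ∀ x : ℝ≥0∞, (x ^ (1 / (2 : ℝ))) ^ 2 = x := fun x => by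
    rw [← ENNReal.rpow_natCast, ← ENNReal.rpow_mul]
    norm_num
  calc _ ≤ _ := pow_le_pow_left' h 2
    _ = _ := by rw [mul_pow, hs, hs]

theorem sq_lintegral_kernel_le {α : Type*} [MeasurableSpace α] {μ : Measure α} {k g : α → ℝ≥0∞}
    (hk : Measurable k) (hg : Measurable g) :
    (∫⁻ x, k x * g x ∂μ) ^ 2 ≤ (∫⁻ x, k x ∂μ) * ∫⁻ x, k x * g x ^ 2 ∂μ := by
  have h := sq_lintegral_mul_le (μ := μ.withDensity k) (f := 1) (g := g)
    measurable_one.aemeasurable hg.aemeasurable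
  simp only [Pi.one_apply, one_mul, one_pow] at h
  rw [lintegral_withDensity_eq_lintegral_mul _ hk hg,
    lintegral_withDensity_eq_lintegral_mul _ hk (hg.pow_const 2), lintegral_one,
    withDensity_apply _ MeasurableSet.univ, Measure.restrict_univ] at h
  exact h

section Kernel

variable {α β : Type*} [MeasurableSpace α] [MeasurableSpace β] {μ : Measure α} {ν : Measure β}
  [SFinite μ] [SFinite ν] {k : α → β → ℝ≥0∞} {g : β → ℝ≥0∞}

/-- The classical Schur test. Its constant is too crude for the theorem; it supplies the finiteness
needed by `lintegral_sq_kernel_le`. -/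
theorem lintegral_sq_kernel_le_mul (hk : Measurable (Function.uncurry k)) (hg : Measurable g)
    {C D : ℝ≥0∞} (hC : ∀ t, ∫⁻ r, k t r ∂ν ≤ C) (hD : ∀ r, ∫⁻ t, k t r ∂μ ≤ D) :
    ∫⁻ t, (∫⁻ r, k t r * g r ∂ν) ^ 2 ∂μ ≤ C * D * ∫⁻ r, g r ^ 2 ∂ν := by
  have hkl : ∀ t, Measurable (k t) := fun t => hk.comp measurable_prodMk_left
  have hkr : ∀ r, Measurable fun t => k t r := fun r => hk.comp measurable_prodMk_right
  have hkg : Measurable (Function.uncurry fun t r => k t r * g r ^ 2) :=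
    hk.mul ((hg.comp measurable_snd).pow_const 2)
  calc ∫⁻ t, (∫⁻ r, k t r * g r ∂ν) ^ 2 ∂μ
      ≤ ∫⁻ t, C * ∫⁻ r, k t r * g r ^ 2 ∂ν ∂μ := lintegral_mono fun t =>
        (sq_lintegral_kernel_le (hkl t) hg).trans (mul_le_mul_left (hC t) _)
    _ = C * ∫⁻ r, (∫⁻ t, k t r ∂μ) * g r ^ 2 ∂ν := by
        refine (lintegral_const_mul _ hkg.lintegral_prod_right').trans ?_
        congr 1
        refine (lintegral_lintegral_swap hkg.aemeasurable).trans ?_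
        exact lintegral_congr fun r => lintegral_mul_const _ (hkr r)
    _ ≤ C * (D * ∫⁻ r, g r ^ 2 ∂ν) := by
        rw [← lintegral_const_mul _ (hg.pow_const 2)]
        gcongr with r
        exact hD r
    _ = _ := (mul_assoc _ _ _).symm

/-- Schur's test for `T T*` with the constant weight, where `T` has the kernel `k`. -/
theorem lintegral_sq_kernel_le (hk : Measurable (Function.uncurry k)) (hg : Measurable g)
    {C : ℝ≥0∞} (hC : ∀ t, ∫⁻ r, k t r * (∫⁻ s, k s r ∂μ) ∂ν ≤ C)
    (hfin : ∫⁻ t, (∫⁻ r, k t r * g r ∂ν) ^ 2 ∂μ ≠ ∞) :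
    ∫⁻ t, (∫⁻ r, k t r * g r ∂ν) ^ 2 ∂μ ≤ C * ∫⁻ r, g r ^ 2 ∂ν := by
  have hkl : ∀ t, Measurable (k t) := fun t => hk.comp measurable_prodMk_left
  have hkr : ∀ r, Measurable fun t => k t r := fun r => hk.comp measurable_prodMk_right
  set Z : α → ℝ≥0∞ := fun t => ∫⁻ r, k t r * g r ∂ν with hZ
  have hZm : Measurable Z := (hk.mul (hg.comp measurable_snd)).lintegral_prod_right'
  set H : β → ℝ≥0∞ := fun r => ∫⁻ t, k t r * Z t ∂μ with hH
  have hHm : Measurable H :=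
    (hk.mul (hZm.comp measurable_fst)).lintegral_prod_left'
  set N : β → ℝ≥0∞ := fun r => ∫⁻ s, k s r ∂μ with hN
  have hNm : Measurable N := hk.lintegral_prod_left'
  set A := ∫⁻ t, Z t ^ 2 ∂μ with hA
  set B := ∫⁻ r, g r ^ 2 ∂ν with hB
  -- With `Z = T g` and `H = T* Z`, this is `⟨T g, Z⟩ = ⟨g, T* Z⟩`.
  have hAeq : A = ∫⁻ r, g r * H r ∂ν := by
    have hm : Measurable (Function.uncurry fun t r => k t r * g r * Z t) :=
      (hk.mul (hg.comp measurable_snd)).mul (hZm.comp measurable_fst)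
    calc A = ∫⁻ t, ∫⁻ r, k t r * g r * Z t ∂ν ∂μ := by
          refine lintegral_congr fun t => ?_
          rw [sq]
          exact (lintegral_mul_const _ ((hkl t).mul hg)).symm
      _ = ∫⁻ r, ∫⁻ t, k t r * g r * Z t ∂μ ∂ν := lintegral_lintegral_swap hm.aemeasurable
      _ = _ := by
          refine lintegral_congr fun r => ?_
          refine Eq.trans ?_ (lintegral_const_mul _ ((hkr r).mul hZm))
          exact lintegral_congr fun t => by ring
  have hH2 : ∫⁻ r, H r ^ 2 ∂ν ≤ C * A := by
    have hm : Measurable (Function.uncurry fun r t => N r * (k t r * Z t ^ 2)) :=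
      (hNm.comp measurable_fst).mul ((hk.comp measurable_swap).mul
        ((hZm.comp measurable_snd).pow_const 2))
    calc ∫⁻ r, H r ^ 2 ∂ν ≤ ∫⁻ r, N r * ∫⁻ t, k t r * Z t ^ 2 ∂μ ∂ν :=
          lintegral_mono fun r => sq_lintegral_kernel_le (hkr r) hZm
      _ = ∫⁻ r, ∫⁻ t, N r * (k t r * Z t ^ 2) ∂μ ∂ν :=
          lintegral_congr fun r => (lintegral_const_mul _ ((hkr r).mul (hZm.pow_const 2))).symm
      _ = ∫⁻ t, ∫⁻ r, N r * (k t r * Z t ^ 2) ∂ν ∂μ := lintegral_lintegral_swap hm.aemeasurable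
      _ = ∫⁻ t, (∫⁻ r, k t r * N r ∂ν) * Z t ^ 2 ∂μ := by
          refine lintegral_congr fun t => ?_
          refine Eq.trans ?_ (lintegral_mul_const _ ((hkl t).mul hNm))
          exact lintegral_congr fun r => by ring
      _ ≤ ∫⁻ t, C * Z t ^ 2 ∂μ := by
          gcongr with t
          exact hC t
      _ = C * A := lintegral_const_mul _ (hZm.pow_const 2)
  -- Cauchy–Schwarz and the bound on `H`; cancelling `A` requires `hfin`.
  have hAA : A * A ≤ C * B * A := by
    calc A * A = A ^ 2 := (sq A).symm
      _ ≤ B * ∫⁻ r, H r ^ 2 ∂ν := by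
          rw [hAeq]
          exact sq_lintegral_mul_le hg.aemeasurable hHm.aemeasurable
      _ ≤ B * (C * A) := by gcongr
      _ = C * B * A := by ring
  rcases eq_or_ne A 0 with h0 | h0
  · rw [h0]
    exact zero_le
  · exact (ENNReal.mul_le_mul_iff_left h0 hfin).1 hAA

end Kernel

/-! ### The delay kernel and its Schur constants. -/

theorem volume_uIoc_inter_Ioc_le {μ : ℝ} (hμ : 0 < μ) (c x e : ℝ) :
    volume (uIoc (x - e) x ∩ Ioc c (c + μ)) ≤
      ENNReal.ofReal (μ * overlap ((x - c) / μ) (e / μ)) := by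
  have key : ∀ u v : ℝ, u ≤ v → min v 1 - max u 0 ≤ max 0 (min 1 v) - max 0 (min 1 u) := by
    intro u v huv
    simp only [max_def, min_def]
    split_ifs <;> linarith
  have key' : ∀ X E : ℝ, min (max (X - E) X) 1 - max (min (X - E) X) 0 ≤ overlap X E := by
    intro X E
    unfold overlap
    rcases le_total (X - E) X with h | h
    · rw [max_eq_right h, min_eq_left h]
      exact (key _ _ h).trans (le_abs_self _)
    · rw [max_eq_left h, min_eq_right h, abs_sub_comm]
      exact (key _ _ h).trans (le_abs_self _)
  rw [uIoc, Ioc_inter_Ioc, Real.volume_Ioc]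
  refine ENNReal.ofReal_le_ofReal ?_
  obtain ⟨X, rfl⟩ : ∃ X, x = c + μ * X := ⟨(x - c) / μ, by field_simp; ring⟩
  obtain ⟨E, rfl⟩ : ∃ E, e = μ * E := ⟨e / μ, by field_simp⟩
  rw [add_sub_cancel_left, mul_div_cancel_left₀ _ hμ.ne', mul_div_cancel_left₀ _ hμ.ne']
  refine le_trans (le_of_eq ?_) (mul_le_mul_of_nonneg_left (key' X E) hμ.le)
  rw [mul_sub, mul_min_of_nonneg _ _ hμ.le, mul_max_of_nonneg _ _ hμ.le,
    mul_max_of_nonneg _ _ hμ.le, mul_min_of_nonneg _ _ hμ.le,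
    show c + μ * X - μ * E = c + μ * (X - E) by ring, max_add_add_left, min_add_add_left,
    min_add_add_left]
  have e : max (c + min (μ * (X - E)) (μ * X)) c = c + max (min (μ * (X - E)) (μ * X)) 0 := by
    rw [← max_add_add_left, add_zero]
  rw [e, mul_zero, mul_one]
  ring

theorem lintegral_volume_uIoc_inter_Ioc_le {h μ p : ℝ} {η : ℝ → ℝ} (hp : 0 ≤ p) (hμ : 0 < μ)
    (hη : Measurable η) (habs : ∀ t, |η t| ≤ μ)
    (hinc : ∀ s t, s ≤ t → η t - η s ≤ (1 + p) * (t - s)) (c : ℝ) :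
    ∫⁻ t, volume (uIoc (t - h - η t) (t - h) ∩ Ioc c (c + μ)) ≤
      ENNReal.ofReal (μ ^ 2 * calF p) := by
  -- Rescaling time and amplitude by the same factor `μ` preserves the slope bound `1 + p`.
  set ζ : ℝ → ℝ := fun x => η (h + c + μ * x) / μ with hζ
  obtain ⟨hint, hle⟩ := integral_overlap_le (η := ζ) hp (by fun_prop)
    (fun x => by rw [hζ, abs_div, abs_of_pos hμ, div_le_one hμ]; exact habs _)
    (fun s x hsx => by
      have := hinc (h + c + μ * s) (h + c + μ * x) (by gcongr)
      rw [hζ, ← sub_div, div_le_iff₀ hμ]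
      linarith)
  set f : ℝ → ℝ := fun x => overlap x (ζ x) with hf
  have hfi : Integrable fun t => μ * f ((t - (h + c)) / μ) :=
    ((hint.comp_div hμ.ne').comp_sub_right (h + c)).const_mul μ
  calc ∫⁻ t, volume (uIoc (t - h - η t) (t - h) ∩ Ioc c (c + μ))
      ≤ ∫⁻ t, ENNReal.ofReal (μ * f ((t - (h + c)) / μ)) := lintegral_mono fun t => by
        have := volume_uIoc_inter_Ioc_le hμ c (t - h) (η t)
        have e : h + c + μ * ((t - (h + c)) / μ) = t := by field_simp; ring
        simp only [hf, hζ, e]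
        rwa [← sub_sub]
    _ = ENNReal.ofReal (∫ t, μ * f ((t - (h + c)) / μ)) :=
        (ofReal_integral_eq_lintegral_ofReal hfi (ae_of_all _ fun t =>
          mul_nonneg hμ.le (overlap_nonneg _ _))).symm
    _ ≤ _ := by
        refine ENNReal.ofReal_le_ofReal ?_
        rw [integral_const_mul, integral_sub_right_eq_self (fun t => f (t / μ)),
          Measure.integral_comp_div, smul_eq_mul, abs_of_pos hμ, ← mul_assoc, ← sq]
        gcongr

/-- The kernel of the operator `y ↦ ∫ r in uIoc (t - h - η t) (t - h), y r`. -/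
def delayKernel (h : ℝ) (η : ℝ → ℝ) (t r : ℝ) : ℝ≥0∞ :=
  (uIoc (t - h - η t) (t - h)).indicator 1 r

theorem measurable_delayKernel (h : ℝ) {η : ℝ → ℝ} (hη : Measurable η) :
    Measurable (Function.uncurry (delayKernel h η)) := by
  have hS : MeasurableSet {q : ℝ × ℝ | q.2 ∈ uIoc (q.1 - h - η q.1) (q.1 - h)} := by
    have e : {q : ℝ × ℝ | q.2 ∈ uIoc (q.1 - h - η q.1) (q.1 - h)} =
        {q | min (q.1 - h - η q.1) (q.1 - h) < q.2} ∩
          {q | q.2 ≤ max (q.1 - h - η q.1) (q.1 - h)} := rfl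
    rw [e]
    exact (measurableSet_lt (by fun_prop) (by fun_prop)).inter
      (measurableSet_le (by fun_prop) (by fun_prop))
  exact (measurable_one (α := ℝ≥0∞)).indicator hS

theorem lintegral_delayKernel_mul (h : ℝ) (η : ℝ → ℝ) (t : ℝ) (f : ℝ → ℝ≥0∞) :
    ∫⁻ r, delayKernel h η t r * f r = ∫⁻ r in uIoc (t - h - η t) (t - h), f r := by
  rw [← lintegral_indicator measurableSet_uIoc]
  refine lintegral_congr fun r => ?_
  unfold delayKernel
  by_cases hr : r ∈ uIoc (t - h - η t) (t - h) <;> simp [hr]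

theorem uIoc_subset_Ioc_of_abs_le {x e μ : ℝ} (he : |e| ≤ μ) :
    uIoc (x - e) x ⊆ Ioc (min (x - e) x) (min (x - e) x + μ) := by
  obtain ⟨h1, h2⟩ := abs_le.1 he
  refine Ioc_subset_Ioc_right ?_
  rcases le_total (x - e) x with h | h
  · rw [max_eq_right h, min_eq_left h]; linarith
  · rw [max_eq_left h, min_eq_right h]; linarith

theorem lintegral_delayKernel_le {h μ : ℝ} {η : ℝ → ℝ} (habs : ∀ t, |η t| ≤ μ) (t : ℝ) :
    ∫⁻ r, delayKernel h η t r ≤ ENNReal.ofReal μ := by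
  unfold delayKernel
  rw [lintegral_indicator_one measurableSet_uIoc]
  refine (measure_mono (uIoc_subset_Ioc_of_abs_le (habs t))).trans ?_
  rw [Real.volume_Ioc, add_sub_cancel_left]

/-- If `r` lies between `t - h - η t` and `t - h`, then `t` is within `μ` of `r + h`. -/
theorem lintegral_delayKernel_left_le {h μ : ℝ} {η : ℝ → ℝ} (habs : ∀ t, |η t| ≤ μ) (r : ℝ) :
    ∫⁻ t, delayKernel h η t r ≤ ENNReal.ofReal (2 * μ) := by
  calc ∫⁻ t, delayKernel h η t r
      ≤ ∫⁻ t, (Icc (r + h - μ) (r + h + μ)).indicator 1 t := by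
        refine lintegral_mono fun t => ?_
        unfold delayKernel
        by_cases hr : r ∈ uIoc (t - h - η t) (t - h)
        · obtain ⟨h1, h2⟩ := abs_le.1 (habs t)
          have ht : t ∈ Icc (r + h - μ) (r + h + μ) := by
            rcases mem_uIoc.1 hr with h3 | h3 <;> constructor <;> linarith [h3.1, h3.2]
          simp [hr, ht]
        · simp [hr]
    _ = _ := by
        rw [lintegral_indicator_one measurableSet_Icc, Real.volume_Icc]
        congr 1
        ring

/-- The row integral of `T T*`: enlarging only the outer interval to length `μ` and exchanging
integrals leaves the overlap with a fixed window. -/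
theorem lintegral_delayKernel_comp_le {h μ p : ℝ} {η : ℝ → ℝ} (hp : 0 ≤ p) (hμ : 0 < μ)
    (hη : Measurable η) (habs : ∀ t, |η t| ≤ μ)
    (hinc : ∀ s t, s ≤ t → η t - η s ≤ (1 + p) * (t - s)) (t : ℝ) :
    ∫⁻ r, delayKernel h η t r * ∫⁻ s, delayKernel h η s r ≤
      ENNReal.ofReal (μ ^ 2 * calF p) := by
  have hk := measurable_delayKernel h hη
  set c := min (t - h - η t) (t - h)
  rw [lintegral_delayKernel_mul]
  calc ∫⁻ r in uIoc (t - h - η t) (t - h), ∫⁻ s, delayKernel h η s r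
      ≤ ∫⁻ r in Ioc c (c + μ), ∫⁻ s, delayKernel h η s r :=
        lintegral_mono_set (uIoc_subset_Ioc_of_abs_le (habs t))
    _ = ∫⁻ s, ∫⁻ r in Ioc c (c + μ), delayKernel h η s r :=
        lintegral_lintegral_swap (hk.comp measurable_swap).aemeasurable
    _ = ∫⁻ s, volume (uIoc (s - h - η s) (s - h) ∩ Ioc c (c + μ)) := by
        refine lintegral_congr fun s => ?_
        unfold delayKernel
        rw [lintegral_indicator_one measurableSet_uIoc, Measure.restrict_apply measurableSet_uIoc]
    _ ≤ _ := lintegral_volume_uIoc_inter_Ioc_le hp hμ hη habs hinc c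

theorem lintegral_sq_delayKernel_le {h μ p : ℝ} {η : ℝ → ℝ} (hp : 0 ≤ p) (hμ : 0 < μ)
    (hη : Measurable η) (habs : ∀ t, |η t| ≤ μ)
    (hinc : ∀ s t, s ≤ t → η t - η s ≤ (1 + p) * (t - s)) {f : ℝ → ℝ≥0∞}
    (hf : AEMeasurable f) (hfin : ∫⁻ r, f r ^ 2 ≠ ∞) :
    ∫⁻ t, (∫⁻ r in uIoc (t - h - η t) (t - h), f r) ^ 2 ≤
      ENNReal.ofReal (μ ^ 2 * calF p) * ∫⁻ r, f r ^ 2 := by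
  have hk := measurable_delayKernel h hη
  have e1 : ∀ t, ∫⁻ r in uIoc (t - h - η t) (t - h), f r =
      ∫⁻ r, delayKernel h η t r * hf.mk f r := fun t => by
    rw [lintegral_delayKernel_mul]
    exact lintegral_congr_ae (ae_restrict_of_ae hf.ae_eq_mk)
  have e2 : ∫⁻ r, f r ^ 2 = ∫⁻ r, hf.mk f r ^ 2 :=
    lintegral_congr_ae (hf.ae_eq_mk.mono fun r hr => by simp only [hr])
  simp_rw [e1]
  rw [e2] at hfin ⊢
  refine lintegral_sq_kernel_le hk hf.measurable_mk
    (lintegral_delayKernel_comp_le hp hμ hη habs hinc) (ne_top_of_le_ne_top ?_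
      (lintegral_sq_kernel_le_mul hk hf.measurable_mk (lintegral_delayKernel_le habs)
        (lintegral_delayKernel_left_le habs)))
  exact ENNReal.mul_ne_top (ENNReal.mul_ne_top ENNReal.ofReal_ne_top ENNReal.ofReal_ne_top) hfin

/-! ### Passage to `L₂[0, ∞)` and the bound for the operator. -/

theorem IsModeratelyVarying.measurable_extend {h μ p : ℝ} {η : ℝ → ℝ}
    (H : IsModeratelyVarying h μ p η) :
    Measurable (fun t => η (max t 0)) ∧ (∀ t, |η (max t 0)| ≤ μ) ∧
      ∀ s t, s ≤ t → η (max t 0) - η (max s 0) ≤ (1 + p) * (t - s) := by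
  have hp := H.p_nonneg
  have hinc : ∀ s t, s ≤ t → η (max t 0) - η (max s 0) ≤ (1 + p) * (t - s) := by
    intro s t hst
    have h1 := H.increment_le (max s 0) (max t 0) (le_max_right _ _) (max_le_max_right _ hst)
    have h2 : max t 0 - max s 0 ≤ t - s := by
      rcases max_cases t 0 with h | h <;> rcases max_cases s 0 with h' | h' <;> linarith
    have h3 := mul_le_mul_of_nonneg_left h2 (by linarith : 0 ≤ 1 + p)
    linarith
  refine ⟨?_, fun t => H.abs_le _ (le_max_right _ _), hinc⟩
  -- Measurability comes from the increment bound: the extended `η`, constant on `t ≤ 0`, is a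
  -- linear function minus a monotone one.
  have hm : Monotone fun t => (1 + p) * t - η (max t 0) := fun s t hst => by
    have := hinc s t hst
    simp only
    linarith
  have := ((measurable_id.const_mul (1 + p)).sub hm.measurable)
  convert this using 1
  ext t
  simp

section L2

variable {n : ℕ}

theorem inL2_iff {v : ℝ → EuclideanSpace ℂ (Fin n)} :
    InL2 v ↔ AEStronglyMeasurable v (volume.restrict (Ici 0)) ∧
      ∫⁻ t in Ici (0 : ℝ), ‖v t‖ₑ ^ 2 ≠ ∞ := by
  unfold InL2 MemLp
  rw [eLpNorm_lt_top_iff_lintegral_rpow_enorm_lt_top (by norm_num) (by norm_num)]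
  simp [lt_top_iff_ne_top]

theorem normSqL2_eq {v : ℝ → EuclideanSpace ℂ (Fin n)} (hv : InL2 v) :
    normSqL2 v = (∫⁻ t in Ici (0 : ℝ), ‖v t‖ₑ ^ 2).toReal := by
  unfold normSqL2
  rw [integral_eq_lintegral_of_nonneg_ae (ae_of_all _ fun t => by positivity)
    ((continuous_pow 2).comp_aestronglyMeasurable hv.1.norm)]
  congr 1
  refine lintegral_congr fun t => ?_
  rw [ENNReal.ofReal_pow (norm_nonneg _), ofReal_norm]

theorem delayOp_eq (h : ℝ) (η : ℝ → ℝ) (y : ℝ → EuclideanSpace ℂ (Fin n)) (t : ℝ) :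
    delayOp h η y t = ∫ r in (t - h - η t)..(t - h), y r := by
  unfold delayOp
  rw [intervalIntegral.integral_comp_add_left]
  congr 1
  ring

theorem memLp_of_inL2 {y : ℝ → EuclideanSpace ℂ (Fin n)} (hy : InL2 y)
    (hy0 : ∀ t, t ≤ 0 → y t = 0) : MemLp y 2 := by
  have : (Ici (0 : ℝ)).indicator y = y := by
    rw [indicator_eq_self]
    intro t ht
    by_contra h
    exact ht (hy0 t (not_le.1 h).le)
  rw [← this]
  exact (memLp_indicator_iff_restrict measurableSet_Ici).2 hy

theorem aestronglyMeasurable_delayOp {h μ p : ℝ} {η : ℝ → ℝ} (H : IsModeratelyVarying h μ p η)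
    {y : ℝ → EuclideanSpace ℂ (Fin n)} (hy : LocallyIntegrable y) :
    AEStronglyMeasurable (delayOp h η y) (volume.restrict (Ici 0)) := by
  have hyi : ∀ a b, IntervalIntegrable y volume a b := fun a b =>
    (hy.integrableOn_isCompact isCompact_uIcc).intervalIntegrable
  have hc := intervalIntegral.continuous_primitive hyi 0
  have hm := H.measurable_extend.1
  have hs : StronglyMeasurable fun t : ℝ =>
      (∫ r in (0 : ℝ)..(t - h), y r) - ∫ r in (0 : ℝ)..(t - h - η (max t 0)), y r :=
    (hc.measurable.comp (by fun_prop : Measurable fun t : ℝ => t - h)).stronglyMeasurable.sub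
      (hc.measurable.comp
        ((measurable_id.sub_const h).sub hm)).stronglyMeasurable
  refine hs.aestronglyMeasurable.congr ?_
  filter_upwards [ae_restrict_mem measurableSet_Ici] with t ht
  rw [delayOp_eq, max_eq_left (mem_Ici.1 ht),
    intervalIntegral.integral_interval_sub_left (hyi _ _) (hyi _ _)]

theorem lintegral_enorm_delayOp_le {h μ p : ℝ} {η : ℝ → ℝ} (H : IsModeratelyVarying h μ p η)
    (hμ : 0 < μ) {y : ℝ → EuclideanSpace ℂ (Fin n)} (hy : InL2 y)
    (hy0 : ∀ t, t ≤ 0 → y t = 0) :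
    ∫⁻ t in Ici (0 : ℝ), ‖delayOp h η y t‖ₑ ^ 2 ≤
      ENNReal.ofReal (μ ^ 2 * calF p) * ∫⁻ t in Ici (0 : ℝ), ‖y t‖ₑ ^ 2 := by
  obtain ⟨hm, habs, hinc⟩ := H.measurable_extend
  have hyL := memLp_of_inL2 hy hy0
  have hyeq : ∫⁻ t in Ici (0 : ℝ), ‖y t‖ₑ ^ 2 = ∫⁻ t, ‖y t‖ₑ ^ 2 := by
    rw [← lintegral_indicator measurableSet_Ici]
    refine lintegral_congr fun t => ?_
    by_cases ht : t ∈ Ici (0 : ℝ)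
    · simp [ht]
    · simp [ht, hy0 t (not_le.1 ht).le]
  have hfin := (inL2_iff.1 hy).2
  rw [hyeq] at hfin ⊢
  calc ∫⁻ t in Ici (0 : ℝ), ‖delayOp h η y t‖ₑ ^ 2
      ≤ ∫⁻ t in Ici (0 : ℝ),
          (∫⁻ r in uIoc (t - h - η (max t 0)) (t - h), ‖y r‖ₑ) ^ 2 := by
        refine setLIntegral_mono' measurableSet_Ici fun t ht => ?_
        rw [max_eq_left (mem_Ici.1 ht), delayOp_eq]
        gcongr
        rw [← enorm_norm, intervalIntegral.norm_intervalIntegral_eq, enorm_norm]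
        exact enorm_integral_le_lintegral_enorm _
    _ ≤ ∫⁻ t, (∫⁻ r in uIoc (t - h - η (max t 0)) (t - h), ‖y r‖ₑ) ^ 2 :=
        setLIntegral_le_lintegral _ _
    _ ≤ _ := lintegral_sq_delayKernel_le H.p_nonneg hμ hm habs hinc hyL.1.enorm hfin

end L2

theorem one_le_calF {p : ℝ} (hp : 0 ≤ p) : 1 ≤ calF p := by
  unfold calF
  split_ifs with h
  · rw [le_div_iff₀ (by linarith)]; linarith
  · rw [le_div_iff₀ (by linarith)]; linarith

theorem inL2_delayOp {n : ℕ} {h μ p : ℝ} {η : ℝ → ℝ} (H : IsModeratelyVarying h μ p η)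
    {y : ℝ → EuclideanSpace ℂ (Fin n)} (hy : InL2 y) (hy0 : ∀ t, t ≤ 0 → y t = 0) :
    InL2 (delayOp h η y) ∧ normSqL2 (delayOp h η y) ≤ μ ^ 2 * calF p * normSqL2 y := by
  have hF : 0 < calF p := zero_lt_one.trans_le (one_le_calF H.p_nonneg)
  have hmeas := aestronglyMeasurable_delayOp H
    ((memLp_of_inL2 hy hy0).locallyIntegrable (by norm_num))
  have hfin := (inL2_iff.1 hy).2
  have hle : ∫⁻ t in Ici (0 : ℝ), ‖delayOp h η y t‖ₑ ^ 2 ≤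
      ENNReal.ofReal (μ ^ 2 * calF p) * ∫⁻ t in Ici (0 : ℝ), ‖y t‖ₑ ^ 2 := by
    -- The rescaling divides by `μ`, so `μ = 0` is separate: then `η` vanishes on `[0, ∞)` and so
    -- does `z`.
    rcases ((abs_nonneg _).trans (H.abs_le 0 le_rfl)).eq_or_lt with h0 | hμ
    · have : ∫⁻ t in Ici (0 : ℝ), ‖delayOp h η y t‖ₑ ^ 2 = 0 := by
        rw [← lintegral_zero (μ := volume.restrict (Ici (0 : ℝ)))]
        refine setLIntegral_congr_fun measurableSet_Ici fun t ht => ?_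
        have := H.abs_le t ht
        rw [← h0, abs_nonpos_iff] at this
        simp [delayOp, this]
      rw [this]
      exact zero_le
    · exact lintegral_enorm_delayOp_le H hμ hy hy0
  have htop := ENNReal.mul_ne_top (ENNReal.ofReal_ne_top (r := μ ^ 2 * calF p)) hfin
  have hz : InL2 (delayOp h η y) := inL2_iff.2 ⟨hmeas, ne_top_of_le_ne_top htop hle⟩
  refine ⟨hz, ?_⟩
  rw [normSqL2_eq hz, normSqL2_eq hy]
  refine (ENNReal.toReal_mono htop hle).trans_eq ?_
  rw [ENNReal.toReal_mul, ENNReal.toReal_ofReal (by positivity)]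

theorem inL2_feedback {n : ℕ} {h μ p : ℝ} {η : ℝ → ℝ} (H : IsModeratelyVarying h μ p η)
    (hμ : 0 < μ) {y : ℝ → EuclideanSpace ℂ (Fin n)} (hy : InL2 y)
    (hy0 : ∀ t, t ≤ 0 → y t = 0) :
    InL2 (feedback h μ p η y) ∧ normSqL2 (feedback h μ p η y) ≤ normSqL2 y := by
  obtain ⟨hz, hle⟩ := inL2_delayOp H hy hy0
  have hF : 0 < calF p := zero_lt_one.trans_le (one_le_calF H.p_nonneg)
  refine ⟨MemLp.neg (f := fun t => (1 / (μ * √(calF p))) • delayOp h η y t)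
    (MemLp.const_smul (f := delayOp h η y) hz (1 / (μ * √(calF p)))), ?_⟩
  have e : normSqL2 (feedback h μ p η y) =
      (1 / (μ * √(calF p))) ^ 2 * normSqL2 (delayOp h η y) := by
    unfold normSqL2 feedback
    rw [← integral_const_mul]
    congr 1
    ext t
    rw [norm_neg, norm_smul, mul_pow, Real.norm_eq_abs, sq_abs]
  rw [e, div_pow, mul_pow, Real.sq_sqrt hF.le, one_pow, div_mul_eq_mul_div, one_mul,
    div_le_iff₀ (by positivity)]
  linarith

/-! ### Elementary properties of `𝓕`. -/

theorem continuousOn_calF : ContinuousOn calF (Ici 0) := by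
  unfold calF
  refine ContinuousOn.if ?_ ?_ ?_
  · rintro p ⟨-, hp⟩
    rw [show {a : ℝ | a < 1} = Iio 1 from rfl, frontier_Iio, mem_singleton_iff] at hp
    subst hp
    norm_num
  · refine ContinuousOn.div (by fun_prop) (by fun_prop) fun p hp => ?_
    have : (0 : ℝ) ≤ p := hp.1
    positivity
  · refine ContinuousOn.div (by fun_prop) (by fun_prop) fun p hp => ?_
    have : (1 : ℝ) ≤ p := by
      have := hp.2
      rwa [show {a : ℝ | ¬a < 1} = Ici 1 by ext; simp, closure_Ici] at this
    positivity

theorem strictMonoOn_calF : StrictMonoOn calF (Ici 0) := by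
  intro p hp q _ hpq
  rw [mem_Ici] at hp
  unfold calF
  split_ifs with h1 h2 h2
  · rw [div_lt_div_iff₀ (by linarith) (by linarith)]
    nlinarith
  · rw [div_lt_div_iff₀ (by linarith) (by linarith)]
    nlinarith
  · linarith
  · rw [div_lt_div_iff₀ (by linarith) (by linarith)]
    nlinarith

theorem calF_zero : calF 0 = 1 := by simp [calF]

theorem calF_lt {p : ℝ} (hp : 0 < p) : calF p < 7 / 4 := by
  unfold calF
  split_ifs with h <;> rw [div_lt_div_iff₀ (by linarith) (by norm_num)] <;> linarith

theorem tendsto_calF : Tendsto calF atTop (𝓝 (7 / 4)) := by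
  have h : Tendsto (fun p : ℝ => 7 / 4 - 1 / 4 * p⁻¹) atTop (𝓝 (7 / 4 - 1 / 4 * 0)) :=
    tendsto_const_nhds.sub (tendsto_inv_atTop_zero.const_mul _)
  rw [mul_zero, sub_zero] at h
  refine h.congr' ?_
  filter_upwards [eventually_ge_atTop 1] with p hp
  unfold calF
  rw [if_neg hp.not_gt]
  field_simp

end

theorem lemma1 :
    -- the bound holds in case C
    (∀ (n : ℕ) (h μ p : ℝ) (η : ℝ → ℝ), IsModeratelyVarying h μ p η →
      ∀ y : ℝ → EuclideanSpace ℂ (Fin n), InL2 y → (∀ t, t ≤ 0 → y t = 0) →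
        (InL2 (delayOp h η y) ∧
          normSqL2 (delayOp h η y) ≤ μ ^ 2 * calF p * normSqL2 y) ∧
        (0 < μ →
          InL2 (feedback h μ p η y) ∧ normSqL2 (feedback h μ p η y) ≤ normSqL2 y)) ∧
    -- properties of the function `𝓕`
    ContinuousOn calF (Ici 0) ∧ StrictMonoOn calF (Ici 0) ∧ calF 0 = 1 ∧
    (∀ p : ℝ, 0 < p → 1 < calF p ∧ calF p < 7 / 4) ∧
    Tendsto calF atTop (𝓝 (7 / 4)) := by
  refine ⟨fun n h μ p η H y hy hy0 => ⟨inL2_delayOp H hy hy0, fun hμ => inL2_feedback H hμ hy hy0⟩,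
    continuousOn_calF, strictMonoOn_calF, calF_zero, fun p hp => ⟨?_, calF_lt hp⟩, tendsto_calF⟩
  rw [← calF_zero]
  exact strictMonoOn_calF self_mem_Ici hp.le hp
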